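/- Let $F$ be a field of characteristic $0$. An extended affine Lie algebra (EALA) over $F$ is a pair $(E,H)$ of a Lie algebra $E$ over $F$ and a subalgebra $H$ satisfying: (EA1) $E$ has an invariant nondegenerate symmetric bilinear form $(\cdot\mid\cdot)$. (EA2) $H\neq 0$ is finite-dimensional, toral and self-centralizing: $E=\bigoplus_{\alpha\in H^*}E_\alpha$ with $E_\alpha=\{e\in E: [h,e]=\alpha(h)e \text{ for all } h\in H\}$, and $E_0=H$. Then every $\alpha\in H^*$ is represented by a unique $t_\alpha\in H$ with $(t_\alpha\mid h)=\alpha(h)$ for all $h\in H$, and one puts $(\alpha\mid\beta)=(t_\alpha\mid t_\beta)$ for $\alpha,\beta\in H^*$. Let $R=\{\alpha\in H^*: E_\alpha\neq 0\}$, $R^0=\{\alpha\in R:(\alpha\mid\alpha)=0\}$ and $R^{\mathrm{an}}=\{\alpha\in R:(\alpha\mid\alpha)\ne 0\}$. The core $E_c$ is the subalgebra of $E$ generated by all $E_\alpha$ with $\alpha\in R^{\mathrm{an}}$. The remaining axioms are: (EA3) For all $\alpha\in R^{\mathrm{an}}$ and $x\in E_\alpha$ the operator $\operatorname{ad}x$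 is locally nilpotent on $E$. (EA4) If $R^{\mathrm{an}}=R_1\cup R_2$ with $(R_1\mid R_2)=0$, then $R_1=\emptyset$ or $R_2=\emptyset$. (EA5) $\{e\in E:[e,E_c]=0\}\subset E_c$. (EA6) The subgroup of $(H^*,+)$ generated by $R^0$ is a free abelian group of finite rank. The centreless core is $E_{cc}=E_c/Z(E_c)$, where $Z(E_c)$ is the centre of $E_c$. **Proposition.** Let $(E,H)$ be an extended affine Lie algebra over $F$. Then $E$ has finite bounded dimension with respect to its grading $E=\bigoplus_{\alpha\in H^*}E_\alpha$: there is a constant $M\in\mathbb N$ such that $\dim_F E_\alpha\le M$ for all $\alpha\in H^*$. The same is true for the core and the centreless core: one has $E_c=\bigoplus_{\alpha\in H^*}(E_c\cap E_\alpha)$ and $E_{cc}=\bigoplus_{\alpha\in H^*}(E_{cc})_\alpha$, where $(E_{cc})_\alpha$ is the image of $E_c\cap E_\alpha$ in $E_{cc}$, and the dimensions of the spaces $E_c\cap E_\alpha$, and likewise those of the spaces $(E_{cc})_\alpha$, are bounded by a constant that does not depend on $\alpha$. -/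

import Mathlib

namespace EALA

/-- `V` is a grading of the vector space `W` (by the index set `ι`): `W` is the direct sum of the
subspaces `V i`. -/
def IsGrading {F W ι : Type*} [Field F] [AddCommGroup W] [Module F W]
    (V : ι → Submodule F W) : Prop :=
  iSupIndep V ∧ ⨆ i, V i = ⊤

/-- The subspaces `V i` are a grading of `W` with respect to which `W` has finite bounded
dimension: a single natural number bounds the dimensions of all homogeneous subspaces. -/
structure HasFiniteBoundedDimension {F W ι : Type*} [Field F] [AddCommGroup W] [Module F W]
    (V : ι → Submodule F W) : Prop where
  isGrading : IsGrading V
  bounded : ∃ M : ℕ, ∀ i, Module.rank F (V i) ≤ M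

section

variable {F E : Type*} [Field F] [LieRing E] [LieAlgebra F E]

/-- The root space `E_α = {e | [h, e] = α(h) e for all h ∈ H}` of a linear form `α` on `H`. -/
def rootSpace (H : LieSubalgebra F E) (α : Module.Dual F H) : Submodule F E where
  carrier := {e | ∀ h : H, ⁅(h : E), e⁆ = α h • e}
  add_mem' := by
    intro a b ha hb h
    rw [lie_add, ha h, hb h, smul_add]
  zero_mem' := by
    intro h
    simp
  smul_mem' := by
    intro c x hx h
    rw [lie_smul, hx h, smul_comm]

/-- (EA1): `B` is an invariant nondegenerate symmetric bilinear form on `E`;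
(EA2): `H` is a nonzero finite-dimensional toral self-centralizing subalgebra of `E`. -/
structure IsToralPair (H : LieSubalgebra F E) (B : LinearMap.BilinForm F E) : Prop where
  symm : ∀ x y : E, B x y = B y x
  invariant : ∀ x y z : E, B ⁅x, y⁆ z = B x ⁅y, z⁆
  nondegenerate : ∀ x : E, (∀ y : E, B x y = 0) → x = 0
  nontrivial : H ≠ ⊥
  finiteDimensional : FiniteDimensional F H
  toral : IsGrading (rootSpace H)
  selfCentralizing : rootSpace H 0 = H.toSubmodule

open Classical in
/-- The element `t_α ∈ H` that represents the linear form `α` through the form `B`, i.e.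
`B t_α h = α h` for all `h ∈ H`. In the presence of (EA1) and (EA2) it exists and is unique, see
`IsToralPair.existsUnique_dualVector`. -/
noncomputable def dualVector (H : LieSubalgebra F E) (B : LinearMap.BilinForm F E)
    (α : Module.Dual F H) : H :=
  if ht : ∃ t : H, ∀ h : H, B t h = α h then ht.choose else 0

/-- Distinct root spaces are orthogonal unless their roots add up to zero. -/
theorem IsToralPair.form_eq_zero {H : LieSubalgebra F E} {B : LinearMap.BilinForm F E}
    (hHB : IsToralPair H B) {α β : Module.Dual F H} (hαβ : α + β ≠ 0) {x y : E}
    (hx : x ∈ rootSpace H α) (hy : y ∈ rootSpace H β) : B x y = 0 := by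
  by_contra hne
  apply hαβ
  ext h
  have h1 := hHB.invariant x h y
  have hx' : ⁅x, (h : E)⁆ = -(α h • x) := by rw [← lie_skew, hx h]
  rw [hx', hy h] at h1
  simp only [map_neg, map_smul, LinearMap.neg_apply, LinearMap.smul_apply, smul_eq_mul] at h1
  have h2 : (α h + β h) * B x y = 0 := by linear_combination -h1
  simpa using (mul_eq_zero.mp h2).resolve_right hne

/-- Every linear form on `H` is represented by a unique element of `H`. -/
theorem IsToralPair.existsUnique_dualVector {H : LieSubalgebra F E}
    {B : LinearMap.BilinForm F E} (hHB : IsToralPair H B) (α : Module.Dual F H) :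
    ∃! t : H, ∀ h : H, B t h = α h := by
  have := hHB.finiteDimensional
  let f : H →ₗ[F] Module.Dual F H :=
    { toFun := fun t => (B t).comp H.toSubmodule.subtype
      map_add' := by intro a b; ext h; simp
      map_smul' := by intro c a; ext h; simp }
  have hf : ∀ t h : H, f t h = B t h := fun _ _ => rfl
  have hinj : Function.Injective f := by
    rw [injective_iff_map_eq_zero]
    intro t ht
    apply Subtype.ext
    apply hHB.nondegenerate
    intro y
    have hy : y ∈ ⨆ β, rootSpace H β := by rw [hHB.toral.2]; trivial
    have ht0 : (t : E) ∈ rootSpace H 0 := by rw [hHB.selfCentralizing]; exact t.2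
    induction hy using Submodule.iSup_induction' with
    | mem β x hx =>
      by_cases hβ : β = 0
      · subst hβ
        rw [hHB.selfCentralizing] at hx
        have := hf t ⟨x, hx⟩
        rw [ht] at this
        exact this.symm
      · exact hHB.form_eq_zero (by simpa using hβ) ht0 hx
    | zero => simp
    | add a b _ _ ha hb => rw [map_add, ha, hb, add_zero]
  have hsurj : Function.Surjective f :=
    (LinearMap.injective_iff_surjective_of_finrank_eq_finrank
      (Subspace.dual_finrank_eq (K := F) (V := H)).symm).1 hinj
  obtain ⟨t, ht⟩ := hsurj α
  refine ⟨t, fun h => by rw [← hf, ht], ?_⟩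
  intro s hs
  apply hinj
  rw [ht]
  ext h
  rw [hf, hs h]

/-- The form `(α | β) = (t_α | t_β)` on the dual space of `H`. -/
noncomputable def dualForm (H : LieSubalgebra F E) (B : LinearMap.BilinForm F E)
    (α β : Module.Dual F H) : F :=
  B (dualVector H B α) (dualVector H B β)

/-- The set `R` of roots of `(E, H)`. It contains `0`. -/
def roots (H : LieSubalgebra F E) : Set (Module.Dual F H) :=
  {α | rootSpace H α ≠ ⊥}

/-- The set of null roots. -/
def nullRoots (H : LieSubalgebra F E) (B : LinearMap.BilinForm F E) :
    Set (Module.Dual F H) :=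
  {α | α ∈ roots H ∧ dualForm H B α α = 0}

/-- The set of anisotropic roots. -/
def anisotropicRoots (H : LieSubalgebra F E) (B : LinearMap.BilinForm F E) :
    Set (Module.Dual F H) :=
  {α | α ∈ roots H ∧ dualForm H B α α ≠ 0}

/-- The core: the subalgebra generated by all anisotropic root spaces. -/
def core (H : LieSubalgebra F E) (B : LinearMap.BilinForm F E) : LieSubalgebra F E :=
  LieSubalgebra.lieSpan F E (⋃ α ∈ anisotropicRoots H B, (rootSpace H α : Set E))

/-- `(E, H)` is an extended affine Lie algebra with respect to the form `B`: axioms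
(EA1), (EA2) (in `IsToralPair`) and (EA3), ..., (EA6). -/
structure IsExtendedAffine (H : LieSubalgebra F E) (B : LinearMap.BilinForm F E) : Prop
    extends IsToralPair H B where
  locallyNilpotent : ∀ α ∈ anisotropicRoots H B, ∀ x ∈ rootSpace H α, ∀ e : E,
    ∃ n : ℕ, ((LieAlgebra.ad F E x) ^ n) e = 0
  connected : ∀ R₁ R₂ : Set (Module.Dual F H), anisotropicRoots H B = R₁ ∪ R₂ →
    (∀ α ∈ R₁, ∀ β ∈ R₂, dualForm H B α β = 0) → R₁ = ∅ ∨ R₂ = ∅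
  tame : ∀ e : E, (∀ x ∈ core H B, ⁅e, x⁆ = 0) → e ∈ core H B
  free : Module.Free ℤ (AddSubgroup.closure (nullRoots H B))
  finiteRank : Module.Finite ℤ (AddSubgroup.closure (nullRoots H B))

/-- The homogeneous subspace `E_c ∩ E_α` of the core. -/
def coreRootSpace (H : LieSubalgebra F E) (B : LinearMap.BilinForm F E)
    (α : Module.Dual F H) : Submodule F (core H B) :=
  (rootSpace H α).comap (core H B).toSubmodule.subtype

/-- The centreless core `E_cc = E_c / Z(E_c)`. -/
abbrev CentrelessCore (H : LieSubalgebra F E) (B : LinearMap.BilinForm F E) : Type _ :=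
  core H B ⧸ LieAlgebra.center F (core H B)

/-- The homogeneous subspace of the centreless core: the image of `E_c ∩ E_α` under the quotient
map, i.e. `(E_c ∩ E_α) / (Z(E_c) ∩ E_α)`. -/
def centrelessCoreRootSpace (H : LieSubalgebra F E) (B : LinearMap.BilinForm F E)
    (α : Module.Dual F H) : Submodule F (CentrelessCore H B) :=
  (coreRootSpace H B α).map
    (LieSubmodule.Quotient.mk' (LieAlgebra.center F (core H B))).toLinearMap

end

end EALA

/-! ### Root spaces, the form on the dual of `H`, and duality of opposite root spaces. -/

namespace EALA

section

variable {F E : Type*} [Field F] [LieRing E] [LieAlgebra F E]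
  {H : LieSubalgebra F E} {B : LinearMap.BilinForm F E}

/-! The bound rests on one finiteness statement: the core is generated by the root spaces of a
finite set J of anisotropic roots (`exists_finite_core_eq_lieSpan`).

Granting it, recall that E_β is at most a line when (β|β) ≠ 0, by sl₂-theory; let z_β span it. In a
degree δ with (δ|δ) = 0, the brackets [z_α, z_{δ-α}] with α ∈ J span the part of the core in E_δ,
because a generator reaches a null root only from an anisotropic one. This bounds the core. By
tameness, the elements of E_δ killed by all ad z_α, α ∈ J, lie in the core, while each ad z_α maps
E_δ into a line; so E_δ exceeds its core part by at most |J| dimensions (`exists_bound`).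

For finite generation, null roots are orthogonal to anisotropic roots
(`dualForm_eq_zero_of_nullRoot`) and Cartan integers are bounded (`cartanNumber_le_six`), which
leaves finitely many classes of anisotropic roots modulo the radical. Two roots of one class differ
by a null root, so by (EA6) the differences within a class generate a finitely generated group G.
Products of two reflections translate a class by twice such differences, and G/2G is finite, so
finitely many root spaces generate all those of the class. -/

theorem lie_mem_rootSpace {α β : Module.Dual F H} {x y : E} (hx : x ∈ rootSpace H α)
    (hy : y ∈ rootSpace H β) : ⁅x, y⁆ ∈ rootSpace H (α + β) := by
  intro h
  rw [leibniz_lie, hx h, hy h, smul_lie, lie_smul, ← add_smul, LinearMap.add_apply]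

theorem mem_roots_of_mem {α : Module.Dual F H} {x : E} (hx : x ∈ rootSpace H α) (h : x ≠ 0) :
    α ∈ roots H := fun h0 => h (by rw [h0] at hx; simpa using hx)

theorem exists_mem_of_mem_roots {α : Module.Dual F H} (h : α ∈ roots H) :
    ∃ x ∈ rootSpace H α, x ≠ 0 := Submodule.exists_mem_ne_zero_of_ne_bot h

namespace IsToralPair

variable (hHB : IsToralPair H B)

include hHB

theorem dualVector_apply (α : Module.Dual F H) (h : H) : B (dualVector H B α) h = α h := by
  have := (hHB.existsUnique_dualVector α).exists
  rw [dualVector, dif_pos this]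
  exact this.choose_spec h

theorem dualForm_eq (α β : Module.Dual F H) : dualForm H B α β = β (dualVector H B α) := by
  rw [dualForm, hHB.symm, hHB.dualVector_apply]

theorem dualForm_eq' (α β : Module.Dual F H) : dualForm H B α β = α (dualVector H B β) := by
  rw [dualForm, hHB.dualVector_apply]

theorem dualForm_comm (α β : Module.Dual F H) : dualForm H B α β = dualForm H B β α :=
  hHB.symm _ _

theorem dualForm_add_left (α β γ : Module.Dual F H) :
    dualForm H B (α + β) γ = dualForm H B α γ + dualForm H B β γ := by
  simp [hHB.dualForm_eq']

theorem dualForm_sub_left (α β γ : Module.Dual F H) :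
    dualForm H B (α - β) γ = dualForm H B α γ - dualForm H B β γ := by
  simp [hHB.dualForm_eq']

theorem dualForm_neg_left (α γ : Module.Dual F H) :
    dualForm H B (-α) γ = - dualForm H B α γ := by
  simp [hHB.dualForm_eq']

theorem dualForm_zsmul_left (n : ℤ) (α γ : Module.Dual F H) :
    dualForm H B (n • α) γ = n * dualForm H B α γ := by
  simp [hHB.dualForm_eq']

theorem dualForm_zero_left (γ : Module.Dual F H) :
    dualForm H B 0 γ = 0 := by
  simp [hHB.dualForm_eq']

theorem dualForm_add_right (α β γ : Module.Dual F H) :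
    dualForm H B γ (α + β) = dualForm H B γ α + dualForm H B γ β := by
  simp [hHB.dualForm_eq]

theorem dualForm_sub_right (α β γ : Module.Dual F H) :
    dualForm H B γ (α - β) = dualForm H B γ α - dualForm H B γ β := by
  simp [hHB.dualForm_eq]

theorem dualForm_neg_right (α γ : Module.Dual F H) :
    dualForm H B γ (-α) = - dualForm H B γ α := by
  simp [hHB.dualForm_eq]

theorem dualForm_zsmul_right (n : ℤ) (α γ : Module.Dual F H) :
    dualForm H B γ (n • α) = n * dualForm H B γ α := by
  simp [hHB.dualForm_eq]

theorem dualForm_smul_right (c : F) (α γ : Module.Dual F H) :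
    dualForm H B γ (c • α) = c * dualForm H B γ α := by
  simp [hHB.dualForm_eq]

/-- Both sides lie in `H` and, by invariance, represent the linear form `B x y • α`; representing
vectors are unique. -/
theorem lie_eq_smul_dualVector {α : Module.Dual F H} {x y : E} (hx : x ∈ rootSpace H α)
    (hy : y ∈ rootSpace H (-α)) : ⁅x, y⁆ = B x y • (dualVector H B α : E) := by
  have h0 : ⁅x, y⁆ ∈ rootSpace H 0 := by simpa using lie_mem_rootSpace hx hy
  rw [hHB.selfCentralizing] at h0
  have hu := (hHB.existsUnique_dualVector (B x y • α)).unique (y₁ := ⟨⁅x, y⁆, h0⟩)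
    (y₂ := B x y • dualVector H B α) (fun h => ?_) (fun h => ?_)
  · simpa using congrArg Subtype.val hu
  · have : ⁅y, (h : E)⁆ = α h • y := by rw [← lie_skew, hy h]; simp
    simp [hHB.invariant, this, mul_comm]
  · simp [hHB.dualVector_apply]

/-- Opposite root spaces are in duality. -/
theorem exists_form_ne_zero {α : Module.Dual F H} {x : E} (hx : x ∈ rootSpace H α) (h : x ≠ 0) :
    ∃ y ∈ rootSpace H (-α), B x y ≠ 0 := by
  by_contra! hc
  refine h (hHB.nondegenerate x fun y => ?_)
  have hy : y ∈ ⨆ β, rootSpace H β := by rw [hHB.toral.2]; trivial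
  induction hy using Submodule.iSup_induction' with
  | mem β z hz =>
    by_cases hβ : α + β = 0
    · rw [eq_neg_of_add_eq_zero_right hβ] at hz
      exact hc z hz
    · exact hHB.form_eq_zero hβ hx hz
  | zero => simp
  | add a b _ _ ha hb => rw [map_add, ha, hb, add_zero]

theorem neg_mem_roots {α : Module.Dual F H} (h : α ∈ roots H) : -α ∈ roots H := by
  obtain ⟨x, hx, hx0⟩ := exists_mem_of_mem_roots h
  obtain ⟨y, hy, hB⟩ := hHB.exists_form_ne_zero hx hx0
  exact mem_roots_of_mem hy (by rintro rfl; simp at hB)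

theorem neg_mem_anisotropicRoots {α : Module.Dual F H} (h : α ∈ anisotropicRoots H B) :
    -α ∈ anisotropicRoots H B :=
  ⟨hHB.neg_mem_roots h.1, by
    rw [hHB.dualForm_neg_left, hHB.dualForm_neg_right, neg_neg]; exact h.2⟩

end IsToralPair

end

end EALA

/-! ### Modules over an sl₂-triple with locally nilpotent action. -/

section SlTwo

variable {F L M : Type*} [Field F] [LieRing L] [LieAlgebra F L]
  [AddCommGroup M] [Module F M] [LieRingModule L M] [LieModule F L M] {h e f : L}

open LieModule

namespace IsSl2Triple

theorem lie_h_pow_toEnd_f_of_weight (t : IsSl2Triple h e f) {m : M} {μ : F}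
    (hm : ⁅h, m⁆ = μ • m) (n : ℕ) :
    ⁅h, (toEnd F L M f ^ n) m⁆ = (μ - 2 * n) • (toEnd F L M f ^ n) m := by
  induction n with
  | zero => simpa using hm
  | succ n ih =>
    rw [pow_succ', Module.End.mul_apply, toEnd_apply_apply, leibniz_lie h, t.lie_lie_smul_f F,
      ← neg_smul, ih, lie_smul, smul_lie, ← add_smul]
    congr 1
    push_cast
    ring

/-- The usual commutation formula for a weight vector that need not be primitive. The extra term in
`⁅e, m⁆` drives the induction in `pow_toEnd_f_ne_zero`. -/
theorem lie_e_pow_succ_toEnd_f_of_weight (t : IsSl2Triple h e f) {m : M} {μ : F}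
    (hm : ⁅h, m⁆ = μ • m) (n : ℕ) :
    ⁅e, (toEnd F L M f ^ (n + 1)) m⁆ = (toEnd F L M f ^ (n + 1)) ⁅e, m⁆ +
      ((n + 1) * (μ - n)) • (toEnd F L M f ^ n) m := by
  induction n with
  | zero => simp [leibniz_lie e, t.lie_e_f, hm, add_comm]
  | succ n ih =>
    rw [pow_succ', Module.End.mul_apply, toEnd_apply_apply, leibniz_lie e, t.lie_e_f,
      t.lie_h_pow_toEnd_f_of_weight hm, ih, lie_add, lie_smul, Module.End.mul_apply,
      toEnd_apply_apply, ← toEnd_apply_apply F L M f ((toEnd F L M f ^ n) m),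
      ← Module.End.mul_apply _ _ m, ← pow_succ', add_left_comm, ← add_smul]
    congr 2
    push_cast
    ring

variable [CharZero F]

/-- The weight of a primitive vector on which `f` acts nilpotently is a natural number. -/
theorem HasPrimitiveVectorWith.exists_nat_of_pow_eq_zero {t : IsSl2Triple h e f} {m : M} {μ : F}
    (P : t.HasPrimitiveVectorWith m μ) (hf : ∃ n : ℕ, (toEnd F L M f ^ n) m = 0) :
    ∃ n : ℕ, μ = n := by
  obtain ⟨n, hn₁, hn₂⟩ := Nat.exists_not_and_succ_of_not_zero_of_exists
    (p := fun n => (toEnd F L M f ^ n) m = 0) P.ne_zero hf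
  refine ⟨n, ?_⟩
  have := P.lie_e_pow_succ_toEnd_f n
  rw [hn₂, lie_zero, eq_comm, smul_eq_zero_iff_left hn₁, mul_eq_zero, sub_eq_zero] at this
  exact this.resolve_left <| Nat.cast_add_one_ne_zero n

/-- The last nonzero `e ^ n` applied to `m` is a primitive vector of weight `μ + 2 * n`, which must
be a natural number. -/
theorem exists_int_of_pow_eq_zero (t : IsSl2Triple h e f) {m : M} {μ : F}
    (hm0 : m ≠ 0) (hm : ⁅h, m⁆ = μ • m)
    (he : ∃ n : ℕ, (toEnd F L M e ^ n) m = 0)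
    (hf : ∀ x : M, ∃ n : ℕ, (toEnd F L M f ^ n) x = 0) :
    ∃ n : ℤ, μ = n := by
  obtain ⟨n, hn₁, hn₂⟩ := Nat.exists_not_and_succ_of_not_zero_of_exists
    (p := fun n => (toEnd F L M e ^ n) m = 0) hm0 he
  have hw := t.symm.lie_h_pow_toEnd_f_of_weight (m := m) (μ := -μ) (by simp [hm]) n
  have P : t.HasPrimitiveVectorWith ((toEnd F L M e ^ n) m) (μ + 2 * n) :=
    { ne_zero := hn₁
      lie_h := by
        rw [neg_lie, neg_eq_iff_eq_neg, ← neg_smul] at hw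
        rw [hw]
        congr 1
        ring
      lie_e := by simpa [pow_succ'] using hn₂ }
  obtain ⟨k, hk⟩ := P.exists_nat_of_pow_eq_zero (hf _)
  exact ⟨k - 2 * n, by push_cast; linear_combination hk⟩

/-- If `e` acts nilpotently on a vector of weight `k`, then `f ^ j` does not kill it for
`j ≤ k`. -/
theorem pow_toEnd_f_ne_zero (t : IsSl2Triple h e f) {m : M} {k : ℕ}
    (hm0 : m ≠ 0) (hm : ⁅h, m⁆ = (k : F) • m) (he : ∃ n : ℕ, (toEnd F L M e ^ n) m = 0)
    {j : ℕ} (hj : j ≤ k) : (toEnd F L M f ^ j) m ≠ 0 := by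
  obtain ⟨n, hn⟩ := he
  induction n generalizing m k j with
  | zero => exact absurd hn hm0
  | succ n ih =>
    intro hfj
    by_cases hem : ⁅e, m⁆ = 0
    · exact HasPrimitiveVectorWith.pow_toEnd_f_ne_zero_of_eq_nat (t := t) (μ := (k : F))
        ⟨hm0, hm, hem⟩ rfl hj hfj
    -- The vector `⁅e, m⁆` has weight `k + 2` and is killed by one power of `e` less. If `f ^ j`
    -- kills `m`, the commutation formula shows that `f ^ (j + 1)` kills `⁅e, m⁆`.
    · refine ih (m := ⁅e, m⁆) (k := k + 2) (j := j + 1) hem ?_ (by omega) ?_ ?_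
      · rw [leibniz_lie, t.lie_h_e_smul F, hm, lie_smul, smul_lie, ← add_smul]
        congr 1
        push_cast
        ring
      · simpa [pow_succ] using hn
      · have := t.lie_e_pow_succ_toEnd_f_of_weight hm j
        rw [hfj, smul_zero, add_zero, pow_succ' _ j, Module.End.mul_apply, hfj, map_zero,
          lie_zero, ← pow_succ'] at this
        exact this.symm

end IsSl2Triple

end SlTwo

/-! ### Integrality, root strings and one-dimensionality for anisotropic roots. -/

namespace EALA

section

variable {F E : Type*} [Field F] [LieRing E] [LieAlgebra F E]
  {H : LieSubalgebra F E} {B : LinearMap.BilinForm F E}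

/-- The number `⟨β, α^∨⟩ = 2 (β | α) / (α | α)`. -/
noncomputable def cartanNumber (H : LieSubalgebra F E) (B : LinearMap.BilinForm F E)
    (β α : Module.Dual F H) : F :=
  2 * dualForm H B β α / dualForm H B α α

theorem pow_ad_mem_rootSpace {α β : Module.Dual F H} {x v : E} (hx : x ∈ rootSpace H α)
    (hv : v ∈ rootSpace H β) (n : ℕ) :
    (LieAlgebra.ad F E x ^ n) v ∈ rootSpace H (β + n • α) := by
  induction n with
  | zero => simpa using hv
  | succ n ih =>
    rw [pow_succ', Module.End.mul_apply, LieAlgebra.ad_apply, succ_nsmul', add_left_comm]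
    exact lie_mem_rootSpace hx ih

variable [CharZero F]

/-- Nondegeneracy provides `y` opposite to `e`, and `⁅e, y⁆` is a nonzero multiple of t_α. Rescaling
`y` turns it into the coroot 2 t_α / (α|α), which acts on E_β by the Cartan number. -/
theorem IsToralPair.exists_sl2Triple (hHB : IsToralPair H B) {α : Module.Dual F H}
    (hα : α ∈ anisotropicRoots H B) :
    ∃ e ∈ rootSpace H α, ∃ f ∈ rootSpace H (-α), ∃ h : E, IsSl2Triple h e f ∧ B e f ≠ 0 ∧
      ∀ β, ∀ x ∈ rootSpace H β, ⁅h, x⁆ = cartanNumber H B β α • x := by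
  obtain ⟨e, he, he0⟩ := exists_mem_of_mem_roots hα.1
  obtain ⟨y, hy, hB⟩ := hHB.exists_form_ne_zero he he0
  have hn := hα.2
  have key : ∀ β, ∀ x ∈ rootSpace H β,
      ⁅((2 / dualForm H B α α) • (dualVector H B α : E)), x⁆ = cartanNumber H B β α • x := by
    intro β x hx
    rw [smul_lie, hx, ← hHB.dualForm_eq', smul_smul, cartanNumber]
    congr 1
    ring
  have h2 : cartanNumber H B α α = 2 := by
    rw [cartanNumber]; field_simp
  refine ⟨e, he, (2 / (dualForm H B α α * B e y)) • y, Submodule.smul_mem _ _ hy, _,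
    ⟨?_, ?_, ?_, ?_⟩, ?_, key⟩
  · intro h0
    have := key α e he
    rw [h0, h2, zero_lie, eq_comm, smul_eq_zero] at this
    exact this.elim two_ne_zero he0
  · rw [lie_smul, hHB.lie_eq_smul_dualVector he hy, smul_smul]
    congr 1
    field_simp
  · rw [key α e he, h2, ofNat_smul_eq_nsmul]
  · rw [key (-α) _ (Submodule.smul_mem _ _ hy), ← ofNat_smul_eq_nsmul F, ← neg_smul, ← h2]
    congr 1
    simp only [cartanNumber, hHB.dualForm_neg_left]
    ring
  · rw [map_smul, smul_eq_mul]
    exact mul_ne_zero (div_ne_zero two_ne_zero (mul_ne_zero hn hB)) hB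

namespace IsExtendedAffine

variable (hE : IsExtendedAffine H B)

include hE

theorem exists_int_cartanNumber {α β : Module.Dual F H} (hα : α ∈ anisotropicRoots H B)
    (hβ : β ∈ roots H) : ∃ n : ℤ, cartanNumber H B β α = n := by
  obtain ⟨e, he, f, hf, h, t, -, key⟩ := hE.exists_sl2Triple hα
  obtain ⟨v, hv, hv0⟩ := exists_mem_of_mem_roots hβ
  exact t.exists_int_of_pow_eq_zero hv0 (key β v hv) (hE.locallyNilpotent α hα e he v)
    (hE.locallyNilpotent _ (hE.neg_mem_anisotropicRoots hα) f hf)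

/-- Root strings: some `f ∈ E_{-α}` has `(ad f)^i v ≠ 0` for all nonzero `v ∈ E_β` and
`i ≤ ⟨β, α^∨⟩`. -/
theorem exists_pow_ad_ne_zero {α : Module.Dual F H} (hα : α ∈ anisotropicRoots H B) :
    ∃ f ∈ rootSpace H (-α), ∀ β, ∀ v ∈ rootSpace H β, v ≠ 0 → ∀ m : ℕ,
      cartanNumber H B β α = m → ∀ i ≤ m, (LieAlgebra.ad F E f ^ i) v ≠ 0 := by
  obtain ⟨e, he, f, hf, h, t, -, key⟩ := hE.exists_sl2Triple hα
  refine ⟨f, hf, fun β v hv hv0 m hm i hi => ?_⟩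
  exact t.pow_toEnd_f_ne_zero hv0 (by rw [key β v hv, hm])
    (hE.locallyNilpotent α hα e he v) hi

theorem sub_nsmul_mem_roots {α β : Module.Dual F H} (hα : α ∈ anisotropicRoots H B)
    (hβ : β ∈ roots H) {m : ℕ} (hm : cartanNumber H B β α = m) {i : ℕ} (hi : i ≤ m) :
    β - i • α ∈ roots H := by
  obtain ⟨f, hf, key⟩ := hE.exists_pow_ad_ne_zero hα
  obtain ⟨v, hv, hv0⟩ := exists_mem_of_mem_roots hβ
  have := mem_roots_of_mem (pow_ad_mem_rootSpace hf hv i) (key β v hv hv0 m hm i hi)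
  rwa [smul_neg, ← sub_eq_add_neg] at this

/-- Anisotropic root spaces are at most one-dimensional. -/
theorem exists_rootSpace_eq_span (α : Module.Dual F H) :
    ∃ z ∈ rootSpace H α, dualForm H B α α ≠ 0 → rootSpace H α = Submodule.span F {z} := by
  by_cases h0 : α ∈ anisotropicRoots H B
  · obtain ⟨e, he, f, hf, h, t, hB, key⟩ := hE.exists_sl2Triple h0
    refine ⟨e, he, fun _ => le_antisymm (fun x hx => ?_) (by simpa using he)⟩
    -- The multiple of `e` is chosen to make the difference orthogonal to `f`, hence killed by ad
    -- `f`. A nonzero vector of weight 2 cannot be killed by `f`.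
    have hu : x - (B x f / B e f) • e ∈ rootSpace H α := sub_mem hx (Submodule.smul_mem _ _ he)
    have hfu : ⁅f, x - (B x f / B e f) • e⁆ = 0 := by
      rw [← lie_skew, hE.lie_eq_smul_dualVector hu hf]
      simp [hB]
    by_cases hu0 : x - (B x f / B e f) • e = 0
    · rw [sub_eq_zero.mp hu0]
      exact Submodule.smul_mem _ _ (Submodule.mem_span_singleton_self e)
    · refine absurd ?_ (t.pow_toEnd_f_ne_zero (k := 2) (j := 1) hu0 ?_
        (hE.locallyNilpotent α h0 e he _) one_le_two)
      · simpa using hfu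
      · rw [key α _ hu, cartanNumber, mul_div_assoc, div_self h0.2]
        norm_num
  · refine ⟨0, zero_mem _, fun hn => ?_⟩
    have : rootSpace H α = ⊥ := by
      by_contra hc
      exact h0 ⟨hc, hn⟩
    simp [this]

end IsExtendedAffine

end

end EALA

/-! ### Finitely many cosets modulo twice a finitely generated group. -/

section FiniteChoice

theorem Set.exists_finite_forall_exists_eq {ι κ : Type*} [Finite κ] (f : ι → κ) :
    ∃ s : Set ι, s.Finite ∧ ∀ i, ∃ j ∈ s, f i = f j :=
  ⟨Set.range fun c : Set.range f => c.2.choose, Set.finite_range _, fun i =>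
    ⟨_, ⟨⟨f i, i, rfl⟩, rfl⟩, (Exists.choose_spec (⟨i, rfl⟩ : ∃ j, f j = f i)).symm⟩⟩

/-- A subset `D` of an abelian group that generates a finitely generated subgroup is covered by
finitely many cosets, with representatives in `D`, of twice a group generated by finitely many
elements of `D`. -/
theorem exists_finite_subset_add_two_nsmul {A : Type*} [AddCommGroup A] (D : Set A)
    (hD : (Submodule.span ℤ D).FG) :
    ∃ S ⊆ D, S.Finite ∧ ∀ x ∈ D, ∃ y ∈ S, ∃ g ∈ AddSubgroup.closure S, x = y + (2 : ℤ) • g := by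
  obtain ⟨T, hTD, hT⟩ := (Submodule.fg_span_iff_fg_span_finset_subset D).1 hD
  set G := Submodule.span ℤ D with hG
  have : Module.Finite ℤ G := Module.Finite.iff_fg.2 hD
  let N : Submodule ℤ G := LinearMap.range (LinearMap.lsmul ℤ G 2)
  -- G/2G is finitely generated and killed by 2.
  have : Finite (G ⧸ N) := by
    apply Module.finite_of_fg_torsion
    rintro ⟨x⟩
    refine ⟨⟨2, by simp⟩, ?_⟩
    change (2 : ℤ) • N.mkQ x = 0
    rw [← map_smul, Submodule.mkQ_apply, Submodule.Quotient.mk_eq_zero]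
    exact ⟨x, rfl⟩
  obtain ⟨s, hs, hsD⟩ := Set.exists_finite_forall_exists_eq
    (fun x : D => N.mkQ ⟨x, Submodule.subset_span x.2⟩)
  -- `T` makes the closure contain all of `G`; `s` supplies the coset representatives.
  refine ⟨T ∪ Subtype.val '' s, Set.union_subset hTD (by simp), T.finite_toSet.union (hs.image _),
    fun x hx => ?_⟩
  obtain ⟨y, hy, hxy⟩ := hsD ⟨x, hx⟩
  rw [← sub_eq_zero, ← map_sub, Submodule.mkQ_apply, Submodule.Quotient.mk_eq_zero] at hxy
  obtain ⟨g, hg⟩ := hxy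
  refine ⟨y, Or.inr ⟨y, hy, rfl⟩, g, ?_, ?_⟩
  · have h1 : (g : A) ∈ Submodule.span ℤ (T : Set A) := hT ▸ g.2
    rw [← AddSubgroup.toIntSubmodule_closure] at h1
    exact AddSubgroup.closure_mono Set.subset_union_left h1
  · have := congrArg Subtype.val hg
    simp only [LinearMap.lsmul_apply, Submodule.coe_smul, AddSubgroupClass.coe_sub] at this
    rw [this]
    abel

end FiniteChoice

/-! ### Null roots lie in the radical; finiteness of the anisotropic roots modulo the radical. -/

namespace EALA

section

variable {F E : Type*} [Field F] [CharZero F] [LieRing E] [LieAlgebra F E]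
  {H : LieSubalgebra F E} {B : LinearMap.BilinForm F E}

/-- Heisenberg modules: if `δ` is a null root not orthogonal to the root `α`, then one of the
half-strings `α + ℕ δ`, `α - ℕ δ` consists of roots, up to finitely many exceptions. -/
theorem IsToralPair.exists_three_le_add_zsmul_mem_roots (hHB : IsToralPair H B)
    {α δ : Module.Dual F H} (hα : α ∈ roots H) (hδ : δ ∈ nullRoots H B)
    (hne : dualForm H B δ α ≠ 0) : ∃ n : ℤ, 3 ≤ |n| ∧ α + n • δ ∈ roots H := by
  obtain ⟨v, hv, hv0⟩ := exists_mem_of_mem_roots hα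
  obtain ⟨x, hx, hx0⟩ := exists_mem_of_mem_roots hδ.1
  obtain ⟨y, hy, hB⟩ := hHB.exists_form_ne_zero hx hx0
  set c : F := B x y * dualForm H B δ α with hc
  have hc0 : c ≠ 0 := mul_ne_zero hB hne
  have hact : ∀ n : ℤ, ∀ w ∈ rootSpace H (α + n • δ), ⁅⁅x, y⁆, w⁆ = c • w := by
    intro n w hw
    rw [hHB.lie_eq_smul_dualVector hx hy, smul_lie, hw, ← hHB.dualForm_eq,
      hHB.dualForm_add_right, hHB.dualForm_zsmul_right, hδ.2, mul_zero, add_zero, smul_smul]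
  by_cases h3 : (LieAlgebra.ad F E x ^ 3) v = 0
  · obtain ⟨n, hn₁, hn₂⟩ := Nat.exists_not_and_succ_of_not_zero_of_exists
      (p := fun n => (LieAlgebra.ad F E x ^ n) v = 0) hv0 ⟨3, h3⟩
    have hw := pow_ad_mem_rootSpace hx hv n
    set w := (LieAlgebra.ad F E x ^ n) v with hwdef
    have hxw : ⁅x, w⁆ = 0 := by
      rw [pow_succ', Module.End.mul_apply] at hn₂
      exact hn₂
    clear_value w
    have hmem : ∀ m : ℕ, (LieAlgebra.ad F E y ^ m) w ∈ rootSpace H (α + ((n : ℤ) - m) • δ) := by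
      intro m
      convert pow_ad_mem_rootSpace hy hw m using 2
      module
    have hlie : ∀ m : ℕ, ⁅x, (LieAlgebra.ad F E y ^ (m + 1)) w⁆ =
        ((m + 1) * c) • (LieAlgebra.ad F E y ^ m) w := by
      intro m
      induction m with
      | zero => simp [leibniz_lie x, hxw, hact n w (by simpa using hw)]
      | succ m ih =>
        rw [pow_succ', Module.End.mul_apply, LieAlgebra.ad_apply, leibniz_lie x, ih,
          hact _ _ (hmem (m + 1)), lie_smul, ← LieAlgebra.ad_apply F E y,
          ← Module.End.mul_apply, ← pow_succ', ← add_smul]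
        congr 1
        push_cast
        ring
    -- As `⁅x, y⁆` acts by the same nonzero scalar `c` along the string and `x` kills `w`,
    -- bracketing with `x` recovers a nonzero multiple of the previous power.
    have hnz : ∀ m : ℕ, (LieAlgebra.ad F E y ^ m) w ≠ 0 := by
      intro m
      induction m with
      | zero => exact hn₁
      | succ m ih =>
        intro h0
        have := hlie m
        rw [h0, lie_zero, eq_comm, smul_eq_zero] at this
        exact this.elim (mul_ne_zero (Nat.cast_add_one_ne_zero m) hc0) ih
    -- `w` has degree `α + n • δ`, so `n + 3` steps down lead to `α - 3 • δ`.
    refine ⟨-3, by norm_num, ?_⟩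
    convert mem_roots_of_mem (hmem (n + 3)) (hnz _) using 3
    push_cast
    ring
  · refine ⟨3, by norm_num, ?_⟩
    rw [ofNat_zsmul]
    exact mem_roots_of_mem (pow_ad_mem_rootSpace hx hv 3) h3

/-- Linear forms that have the same inner products with all anisotropic roots. -/
def RadEquiv (H : LieSubalgebra F E) (B : LinearMap.BilinForm F E) (β β' : Module.Dual F H) :
    Prop :=
  ∀ γ ∈ anisotropicRoots H B, dualForm H B β γ = dualForm H B β' γ

namespace IsExtendedAffine

variable (hE : IsExtendedAffine H B)

include hE

/-- Let k = ⟨δ, α^∨⟩ ≠ 0. A root β = α + nδ with |n| ≥ 3 has (β|β) = (α|α)(1 + nk), and ⟨δ, β^∨⟩ =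
k/(1 + nk) must be an integer. But |1 + nk| ≥ 3|k| - 1 ≥ 2|k| > |k|. -/
theorem dualForm_eq_zero_of_nullRoot {α δ : Module.Dual F H} (hδ : δ ∈ nullRoots H B)
    (hα : α ∈ anisotropicRoots H B) : dualForm H B δ α = 0 := by
  by_contra hne
  obtain ⟨n, hn, hβ⟩ := hE.exists_three_le_add_zsmul_mem_roots hα.1 hδ hne
  obtain ⟨k, hk⟩ := hE.exists_int_cartanNumber hα hδ.1
  have hα2 := hα.2
  rw [cartanNumber, div_eq_iff hα2] at hk
  have hk0 : k ≠ 0 := by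
    rintro rfl
    exact hne (by simpa using hk)
  have hnorm : dualForm H B (α + n • δ) (α + n • δ) =
      dualForm H B α α * ((1 + n * k : ℤ) : F) := by
    simp only [hE.dualForm_add_left, hE.dualForm_add_right, hE.dualForm_zsmul_left,
      hE.dualForm_zsmul_right, hδ.2, hE.dualForm_comm α δ]
    push_cast
    linear_combination n * hk
  have hk1 : 1 ≤ |k| := Int.one_le_abs hk0
  have hnk : 2 * |k| ≤ |1 + n * k| := by
    have h1 : |n * k| ≤ |1 + n * k| + |(-1 : ℤ)| := by
      simpa using abs_add_le (1 + n * k) (-1)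
    rw [abs_mul] at h1
    norm_num at h1
    nlinarith
  have hnk0 : (1 + n * k : ℤ) ≠ 0 := by
    intro h0
    rw [h0, abs_zero] at hnk
    omega
  have hβa : α + n • δ ∈ anisotropicRoots H B :=
    ⟨hβ, by rw [hnorm]; exact mul_ne_zero hα2 (Int.cast_ne_zero.2 hnk0)⟩
  obtain ⟨j, hj⟩ := hE.exists_int_cartanNumber hβa hδ.1
  rw [cartanNumber, div_eq_iff hβa.2, hnorm, hE.dualForm_add_right, hE.dualForm_zsmul_right,
    hδ.2, mul_zero, add_zero, hk] at hj
  have hjk : k = j * (1 + n * k) := by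
    have : (k : F) = ((j * (1 + n * k) : ℤ) : F) := by
      apply mul_right_cancel₀ hα2
      rw [hj]
      push_cast
      ring
    exact_mod_cast this
  have := Int.le_of_dvd (abs_pos.2 hk0) ((abs_dvd_abs _ _).2 (Dvd.intro_left j hjk.symm))
  omega

/-- If a ≥ 7, the root string contains γ = β - 3α, and ⟨γ, α^∨⟩ = a - 6 ≠ 0 makes γ anisotropic.
With b = ⟨α, β^∨⟩, integrality of ⟨α, γ^∨⟩ says that a - 3b(a - 3) divides b(a - 6), which is
nonzero and smaller in absolute value. Only boundedness matters later, not the value 6. -/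
theorem cartanNumber_le_six {α β : Module.Dual F H} (hα : α ∈ anisotropicRoots H B)
    (hβ : β ∈ anisotropicRoots H B) {a : ℤ} (ha : cartanNumber H B β α = a) : a ≤ 6 := by
  by_contra! h7
  have hα2 := hα.2
  have hγ : β - 3 • α ∈ roots H := by
    refine hE.sub_nsmul_mem_roots hα hβ.1 (m := a.toNat) ?_ (by omega)
    rw [ha, ← Int.cast_natCast, Int.toNat_of_nonneg (by omega)]
  rw [← natCast_zsmul] at hγ
  rw [cartanNumber, div_eq_iff hα2] at ha
  have hγα : 2 * dualForm H B (β - ((3 : ℕ) : ℤ) • α) α = ((a - 6 : ℤ) : F) * dualForm H B α α := by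
    rw [hE.dualForm_sub_left, hE.dualForm_zsmul_left]
    push_cast
    linear_combination ha
  have hγa : β - ((3 : ℕ) : ℤ) • α ∈ anisotropicRoots H B := by
    refine ⟨hγ, fun h0 => ?_⟩
    rw [hE.dualForm_eq_zero_of_nullRoot ⟨hγ, h0⟩ hα, mul_zero, eq_comm, mul_eq_zero,
      Int.cast_eq_zero] at hγα
    exact hγα.elim (by omega) hα2
  obtain ⟨b, hb⟩ := hE.exists_int_cartanNumber hβ hα.1
  obtain ⟨c, hc⟩ := hE.exists_int_cartanNumber hγa hα.1
  rw [cartanNumber, div_eq_iff hβ.2, hE.dualForm_comm, ha] at hb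
  rw [cartanNumber, div_eq_iff hγa.2, hE.dualForm_comm, hγα] at hc
  simp only [hE.dualForm_sub_left, hE.dualForm_sub_right, hE.dualForm_zsmul_left,
    hE.dualForm_zsmul_right, hE.dualForm_comm α β] at hc
  have hint : b * (a - 6) = c * (a - 3 * b * (a - 3)) := by
    have : ((b * (a - 6) : ℤ) : F) = ((c * (a - 3 * b * (a - 3)) : ℤ) : F) := by
      apply mul_right_cancel₀ hα2
      push_cast at hc ⊢
      linear_combination b * hc - c * hb - 3 * b * c * ha
    exact_mod_cast this
  have hb0 : b ≠ 0 := by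
    rintro rfl
    rw [Int.cast_zero, zero_mul, mul_eq_zero, Int.cast_eq_zero] at hb
    exact hb.elim (by omega) hα2
  have hle := Int.le_of_dvd (abs_pos.2 (mul_ne_zero hb0 (by omega : a - 6 ≠ 0)))
    ((abs_dvd_abs _ _).2 (Dvd.intro_left c hint.symm))
  rw [abs_mul, abs_of_pos (by omega : 0 < a - 6)] at hle
  rcases lt_or_gt_of_ne hb0 with hneg | hpos
  · rw [abs_of_neg hneg] at hle
    have := (abs_le.1 hle).2
    nlinarith
  · rw [abs_of_pos hpos] at hle
    have := (abs_le.1 hle).1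
    nlinarith

theorem abs_cartanNumber_le_six {α β : Module.Dual F H} (hα : α ∈ anisotropicRoots H B)
    (hβ : β ∈ anisotropicRoots H B) {a : ℤ} (ha : cartanNumber H B β α = a) : |a| ≤ 6 := by
  rw [abs_le']
  refine ⟨hE.cartanNumber_le_six hα hβ ha,
    hE.cartanNumber_le_six (hE.neg_mem_anisotropicRoots hα) hβ ?_⟩
  rw [Int.cast_neg, ← ha]
  simp only [cartanNumber, hE.dualForm_neg_left, hE.dualForm_neg_right]
  ring

/-- Equivalence forces ⟨β, β'^∨⟩ = 2, so β' can be subtracted once along the root string, and the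
difference is isotropic. -/
theorem sub_mem_nullRoots {β β' : Module.Dual F H} (hβ : β ∈ anisotropicRoots H B)
    (hβ' : β' ∈ anisotropicRoots H B) (h : RadEquiv H B β β') : β - β' ∈ nullRoots H B := by
  constructor
  · have := hE.sub_nsmul_mem_roots hβ' hβ.1 (m := 2) (i := 1) ?_ one_le_two
    · simpa using this
    · rw [cartanNumber, h β' hβ', mul_div_assoc, div_self hβ'.2]
      norm_num
  · rw [hE.dualForm_sub_right, hE.dualForm_sub_left, hE.dualForm_sub_left, h β hβ, h β' hβ']
    ring

/-- Modulo the radical of the form there are only finitely many anisotropic roots. -/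
theorem exists_finite_radEquiv : ∃ S ⊆ anisotropicRoots H B, S.Finite ∧
    ∀ β ∈ anisotropicRoots H B, ∃ s ∈ S, RadEquiv H B β s := by
  have := hE.finiteDimensional
  obtain ⟨T, hTR, hT⟩ := (Submodule.fg_span_iff_fg_span_finset_subset
    (anisotropicRoots H B)).1 (IsNoetherian.noetherian (Submodule.span F (anisotropicRoots H B)))
  -- The class of β is determined by its Cartan numbers against the finite spanning set `T`, and
  -- these take finitely many values.
  have hint : ∀ (β : anisotropicRoots H B) (τ : T), ∃ n : Set.Icc (-6 : ℤ) 6,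
      cartanNumber H B β τ = (n : ℤ) := fun β τ => by
    obtain ⟨n, hn⟩ := hE.exists_int_cartanNumber (hTR τ.2) β.2.1
    exact ⟨⟨n, abs_le.1 (hE.abs_cartanNumber_le_six (hTR τ.2) β.2 hn)⟩, hn⟩
  choose f hf using hint
  obtain ⟨S, hS, hfS⟩ := Set.exists_finite_forall_exists_eq f
  refine ⟨Subtype.val '' S, by simp, hS.image _, fun β hβ => ?_⟩
  obtain ⟨s, hs, hβs⟩ := hfS ⟨β, hβ⟩
  refine ⟨s, ⟨s, hs, rfl⟩, fun γ hγ => ?_⟩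
  have hγ' : γ ∈ Submodule.span F (T : Set (Module.Dual F H)) := hT ▸ Submodule.subset_span hγ
  clear hγ
  induction hγ' using Submodule.span_induction with
  | mem τ hτ =>
    have h1 := hf ⟨β, hβ⟩ ⟨τ, hτ⟩
    rw [hβs, ← hf s ⟨τ, hτ⟩, cartanNumber, cartanNumber, div_left_inj' (hTR hτ).2] at h1
    exact mul_left_cancel₀ two_ne_zero h1
  | zero => simp [hE.dualForm_comm _ 0, hE.dualForm_zero_left]
  | add a b _ _ ha hb => rw [hE.dualForm_add_right, hE.dualForm_add_right, ha, hb]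
  | smul c a _ ha => rw [hE.dualForm_smul_right, hE.dualForm_smul_right, ha]

end IsExtendedAffine

end

end EALA

/-! ### Reflections, translations and finite generation of the core. -/

namespace EALA

section

variable {F E : Type*} [Field F] [CharZero F] [LieRing E] [LieAlgebra F E]
  {H : LieSubalgebra F E} {B : LinearMap.BilinForm F E}

omit [CharZero F] in
theorem IsToralPair.dualForm_reflection (hHB : IsToralPair H B) {α β : Module.Dual F H}
    (hα : dualForm H B α α ≠ 0) {m : ℤ} (hm : cartanNumber H B β α = m) :
    dualForm H B (β - m • α) (β - m • α) = dualForm H B β β := by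
  rw [cartanNumber, div_eq_iff hα] at hm
  simp only [hHB.dualForm_sub_left, hHB.dualForm_sub_right, hHB.dualForm_zsmul_left,
    hHB.dualForm_zsmul_right, hHB.dualForm_comm α β]
  linear_combination -m * hm

namespace IsExtendedAffine

variable (hE : IsExtendedAffine H B)

include hE

/-- A subalgebra containing the root spaces of `α`, `-α` and `β` contains the root space of the
reflected root; case of a nonnegative Cartan number. -/
theorem rootSpace_reflection_le_of_nat {K : LieSubalgebra F E} {α β : Module.Dual F H}
    (hα : α ∈ anisotropicRoots H B) (hβ : β ∈ anisotropicRoots H B)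
    (hK : rootSpace H (-α) ≤ K.toSubmodule) (hKβ : rootSpace H β ≤ K.toSubmodule) {m : ℕ}
    (hm : cartanNumber H B β α = m) :
    β - (m : ℤ) • α ∈ anisotropicRoots H B ∧ rootSpace H (β - (m : ℤ) • α) ≤ K.toSubmodule := by
  have hnorm := hE.dualForm_reflection hα.2 (m := m) (by rw [hm, Int.cast_natCast])
  have hγ : dualForm H B (β - (m : ℤ) • α) (β - (m : ℤ) • α) ≠ 0 := by rw [hnorm]; exact hβ.2
  obtain ⟨f, hf, key⟩ := hE.exists_pow_ad_ne_zero hα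
  obtain ⟨v, hv, hv0⟩ := exists_mem_of_mem_roots hβ.1
  have hw := pow_ad_mem_rootSpace hf hv m
  have hw0 := key β v hv hv0 m hm m le_rfl
  have hwK : ∀ i : ℕ, (LieAlgebra.ad F E f ^ i) v ∈ K := by
    intro i
    induction i with
    | zero => exact hKβ hv
    | succ i ih =>
      rw [pow_succ', Module.End.mul_apply]
      exact K.lie_mem (hK hf) ih
  rw [smul_neg, ← sub_eq_add_neg, ← natCast_zsmul] at hw
  refine ⟨⟨mem_roots_of_mem hw hw0, hγ⟩, ?_⟩
  -- The reflected root space is a line, so the one nonzero vector already found in `K` spans it.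
  obtain ⟨z, -, hz⟩ := hE.exists_rootSpace_eq_span (β - (m : ℤ) • α)
  rw [hz hγ, Submodule.mem_span_singleton] at hw
  obtain ⟨c, hc⟩ := hw
  have hc0 : c ≠ 0 := by
    rintro rfl
    exact hw0 (by rw [← hc, zero_smul])
  rw [hz hγ, Submodule.span_singleton_le_iff_mem]
  have : z = c⁻¹ • (LieAlgebra.ad F E f ^ m) v := by rw [← hc, inv_smul_smul₀ hc0]
  rw [this]
  exact K.smul_mem _ (hwK m)

theorem rootSpace_reflection_le {K : LieSubalgebra F E} {α β : Module.Dual F H}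
    (hα : α ∈ anisotropicRoots H B) (hβ : β ∈ anisotropicRoots H B)
    (hK : rootSpace H α ≤ K.toSubmodule) (hK' : rootSpace H (-α) ≤ K.toSubmodule)
    (hKβ : rootSpace H β ≤ K.toSubmodule) {m : ℤ} (hm : cartanNumber H B β α = m) :
    β - m • α ∈ anisotropicRoots H B ∧ rootSpace H (β - m • α) ≤ K.toSubmodule := by
  obtain ⟨n, rfl | rfl⟩ := m.eq_nat_or_neg
  · exact hE.rootSpace_reflection_le_of_nat hα hβ hK' hKβ (by rw [hm, Int.cast_natCast])
  · have := hE.rootSpace_reflection_le_of_nat (hE.neg_mem_anisotropicRoots hα) hβ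
      (by rwa [neg_neg]) hKβ (m := n) ?_
    · rwa [smul_neg, ← neg_smul] at this
    · rw [Int.cast_neg, Int.cast_natCast] at hm
      rw [← neg_eq_iff_eq_neg.2 hm]
      simp only [cartanNumber, hE.dualForm_neg_left, hE.dualForm_neg_right]
      ring

/-- The product of the reflections in `α` and `α'` acts as a translation by `2 (α' - α)`. -/
theorem rootSpace_translation_le {K : LieSubalgebra F E} {α α' β : Module.Dual F H}
    (hα : α ∈ anisotropicRoots H B) (hα' : α' ∈ anisotropicRoots H B)
    (hβ : β ∈ anisotropicRoots H B) (hαα' : RadEquiv H B α' α) (hβα : RadEquiv H B β α)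
    (hK : rootSpace H α ≤ K.toSubmodule) (hK' : rootSpace H (-α) ≤ K.toSubmodule)
    (hK₁ : rootSpace H α' ≤ K.toSubmodule) (hK₁' : rootSpace H (-α') ≤ K.toSubmodule)
    (hKβ : rootSpace H β ≤ K.toSubmodule) :
    β + (2 : ℤ) • (α' - α) ∈ anisotropicRoots H B ∧
      rootSpace H (β + (2 : ℤ) • (α' - α)) ≤ K.toSubmodule := by
  obtain ⟨h1, h2⟩ := hE.rootSpace_reflection_le (m := 2) hα hβ hK hK' hKβ (by
    rw [cartanNumber, hβα α hα, mul_div_assoc, div_self hα.2]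
    norm_num)
  -- Modulo the radical β, α and α' agree, so β - 2α has Cartan number 2 - 4 = -2 against α'.
  have h3 := hE.rootSpace_reflection_le (m := -2) hα' h1 hK₁ hK₁' h2 (by
    have hα2 := hα'.2
    rw [cartanNumber, hE.dualForm_sub_left, hE.dualForm_zsmul_left, hβα α' hα', ← hαα' α' hα',
      div_eq_iff hα'.2]
    push_cast
    ring)
  rwa [show β - (2 : ℤ) • α - (-2 : ℤ) • α' = β + (2 : ℤ) • (α' - α) by module] at h3

/-- Finitely many anisotropic root spaces generate all those in a given class modulo the radical
of the form. -/
theorem exists_finite_generators_of_radEquiv {α : Module.Dual F H}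
    (hα : α ∈ anisotropicRoots H B) :
    ∃ J ⊆ anisotropicRoots H B, J.Finite ∧ ∀ K : LieSubalgebra F E,
      (∀ γ ∈ J, rootSpace H γ ≤ K.toSubmodule) →
      ∀ β ∈ anisotropicRoots H B, RadEquiv H B β α → rootSpace H β ≤ K.toSubmodule := by
  let D : Set (Module.Dual F H) := {δ | α + δ ∈ anisotropicRoots H B ∧ RadEquiv H B (α + δ) α}
  have hDnull : D ⊆ nullRoots H B := fun δ hδ => by
    simpa using hE.sub_mem_nullRoots hδ.1 hα hδ.2
  -- By (EA6), `D` spans a subgroup of a finitely generated abelian group.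
  have hfg : (Submodule.span ℤ D).FG := by
    have h1 : (Submodule.span ℤ (nullRoots H B)).FG := by
      rw [← AddSubgroup.toIntSubmodule_closure]
      exact Module.Finite.iff_fg.1 hE.finiteRank
    have := isNoetherian_of_fg_of_noetherian _ h1
    exact (isNoetherian_submodule.1 this) _ (Submodule.span_mono hDnull)
  obtain ⟨S, hSD, hS, hDS⟩ := exists_finite_subset_add_two_nsmul D hfg
  refine ⟨{α, -α} ∪ ((fun δ => α + δ) '' S ∪ (fun δ => -(α + δ)) '' S), ?_,
    (Set.toFinite _).union ((hS.image _).union (hS.image _)), fun K hK β hβ hβα => ?_⟩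
  · rintro γ ((rfl | rfl) | ⟨δ, hδ, rfl⟩ | ⟨δ, hδ, rfl⟩)
    · exact hα
    · exact hE.neg_mem_anisotropicRoots hα
    · exact (hSD hδ).1
    · exact hE.neg_mem_anisotropicRoots (hSD hδ).1
  · have hKα := hK α (Or.inl (Or.inl rfl))
    have hKα' := hK (-α) (Or.inl (Or.inr rfl))
    have hKS : ∀ δ ∈ S, rootSpace H (α + δ) ≤ K.toSubmodule := fun δ hδ =>
      hK _ (Or.inr (Or.inl ⟨δ, hδ, rfl⟩))
    have hKS' : ∀ δ ∈ S, rootSpace H (-(α + δ)) ≤ K.toSubmodule := fun δ hδ =>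
      hK _ (Or.inr (Or.inr ⟨δ, hδ, rfl⟩))
    let P : Module.Dual F H → Prop := fun β =>
      β ∈ anisotropicRoots H B ∧ RadEquiv H B β α ∧ rootSpace H β ≤ K.toSubmodule
    -- Both signs are carried along so that the induction passes through negatives; exchanging the
    -- two reflections inverts the translation.
    have htrans : ∀ g ∈ AddSubgroup.closure S, ∀ β, P β →
        P (β + (2 : ℤ) • g) ∧ P (β + (2 : ℤ) • (-g)) := by
      intro g hg
      induction hg using AddSubgroup.closure_induction with
      | mem δ hδ =>
        rintro β ⟨h1, h2, h3⟩
        have hδD := hSD hδ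
        have hrad : ∀ γ ∈ anisotropicRoots H B, dualForm H B δ γ = 0 := fun γ hγ =>
          hE.dualForm_eq_zero_of_nullRoot (hDnull hδD) hγ
        have ht := hE.rootSpace_translation_le hα hδD.1 h1 hδD.2 h2 hKα hKα' (hKS δ hδ)
          (hKS' δ hδ) h3
        have ht' := hE.rootSpace_translation_le hδD.1 hα h1 (fun γ hγ => (hδD.2 γ hγ).symm)
          (fun γ hγ => (h2 γ hγ).trans (hδD.2 γ hγ).symm) (hKS δ hδ) (hKS' δ hδ) hKα hKα' h3
        rw [add_sub_cancel_left] at ht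
        rw [sub_add_cancel_left] at ht'
        refine ⟨⟨ht.1, fun γ hγ => ?_, ht.2⟩, ⟨ht'.1, fun γ hγ => ?_, ht'.2⟩⟩
        · rw [hE.dualForm_add_left, hE.dualForm_zsmul_left, hrad γ hγ, mul_zero, add_zero, h2 γ hγ]
        · rw [hE.dualForm_add_left, hE.dualForm_zsmul_left, hE.dualForm_neg_left, hrad γ hγ,
            neg_zero, mul_zero, add_zero, h2 γ hγ]
      | zero => simp
      | add a b _ _ ha hb =>
        intro β hβ
        constructor
        · rw [smul_add, ← add_assoc]
          exact (hb _ (ha β hβ).1).1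
        · rw [neg_add, smul_add, ← add_assoc]
          exact (hb _ (ha β hβ).2).2
      | neg a _ ha =>
        intro β hβ
        rw [neg_neg]
        exact (ha β hβ).symm
    obtain ⟨δ, hδ, g, hg, hβg⟩ := hDS (β - α) ⟨by simpa using hβ, by simpa using hβα⟩
    have := (htrans g hg (α + δ) ⟨(hSD hδ).1, (hSD hδ).2, hKS δ hδ⟩).1.2.2
    rwa [add_assoc, ← hβg, add_sub_cancel] at this

/-- The core is generated by finitely many anisotropic root spaces. -/
theorem exists_finite_core_eq_lieSpan : ∃ J : Finset (Module.Dual F H),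
    (J : Set (Module.Dual F H)) ⊆ anisotropicRoots H B ∧
      core H B = LieSubalgebra.lieSpan F E (⋃ α ∈ J, (rootSpace H α : Set E)) := by
  obtain ⟨S, hSR, hS, hrad⟩ := hE.exists_finite_radEquiv
  have hgen : ∀ s : S, _ := fun s => hE.exists_finite_generators_of_radEquiv (hSR s.2)
  choose J hJR hJ hgen using hgen
  have := hS.to_subtype
  obtain ⟨T, hT⟩ := (Set.finite_iUnion hJ).exists_finset_coe
  refine ⟨T, hT ▸ Set.iUnion_subset hJR, le_antisymm ?_ ?_⟩
  · refine LieSubalgebra.lieSpan_le.2 (Set.iUnion₂_subset fun β hβ => ?_)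
    obtain ⟨s, hs, hβs⟩ := hrad β hβ
    refine hgen ⟨s, hs⟩ _ (fun γ hγ x hx => LieSubalgebra.subset_lieSpan ?_) β hβ hβs
    refine Set.mem_iUnion₂.2 ⟨γ, ?_, hx⟩
    rw [← Finset.mem_coe, hT]
    exact Set.mem_iUnion.2 ⟨_, hγ⟩
  · refine LieSubalgebra.lieSpan_mono (Set.biUnion_subset_biUnion_left fun γ hγ => ?_)
    exact Set.iUnion_subset hJR (hT ▸ hγ)

end IsExtendedAffine

end

end EALA

/-! ### Graded subspaces and quotients, and the dimension bound. -/

namespace EALA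

section LinearAlgebra

variable {F W W' ι : Type*} [Field F] [AddCommGroup W] [Module F W] [AddCommGroup W'] [Module F W']

theorem mem_of_mem_iSup_of_le {V U : ι → Submodule F W} (hV : iSupIndep V) (hU : ∀ i, U i ≤ V i)
    {x : W} (hx : x ∈ ⨆ i, U i) {i : ι} (hxi : x ∈ V i) : x ∈ U i := by
  rw [iSup_split_single U i] at hx
  obtain ⟨a, ha, b, hb, rfl⟩ := Submodule.mem_sup.1 hx
  have hb' : b ∈ ⨆ j, ⨆ (_ : j ≠ i), V j := (iSup₂_mono fun j _ => hU j) hb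
  have hbi : b ∈ V i := by simpa using sub_mem hxi (hU i ha)
  rw [Submodule.disjoint_def.1 (hV i) b hbi hb', add_zero]
  exact ha

theorem IsGrading.comap_subtype {V : ι → Submodule F W} (hV : IsGrading V) {N : Submodule F W}
    (hN : N ≤ ⨆ i, V i ⊓ N) : IsGrading fun i => (V i).comap N.subtype := by
  constructor
  · intro i
    rw [Submodule.disjoint_def]
    intro x hx hx'
    apply Subtype.ext
    refine Submodule.disjoint_def.1 (hV.1 i) x hx ?_
    have h1 := Submodule.mem_map_of_mem (f := N.subtype) hx'
    simp only [Submodule.map_iSup] at h1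
    exact (iSup₂_mono fun j _ => Submodule.map_comap_le _ _) h1
  · apply Submodule.map_injective_of_injective N.injective_subtype
    rw [Submodule.map_iSup, Submodule.map_subtype_top]
    simp only [Submodule.map_comap_subtype]
    refine le_antisymm (iSup_le fun i => inf_le_left) ?_
    simpa only [inf_comm N] using hN

/-- The condition `hker` expresses that the kernel of `f` is graded: it contains the homogeneous
components of its elements. -/
theorem IsGrading.map {V : ι → Submodule F W} (hV : IsGrading V) {f : W →ₗ[F] W'}
    (hf : Function.Surjective f)
    (hker : ∀ i, ∀ x ∈ V i, ∀ y ∈ ⨆ j, ⨆ (_ : j ≠ i), V j, f x = f y → f x = 0) :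
    IsGrading fun i => (V i).map f := by
  constructor
  · intro i
    rw [Submodule.disjoint_def]
    rintro _ ⟨x, hx, rfl⟩ hx'
    simp only [← Submodule.map_iSup] at hx'
    obtain ⟨y, hy, hxy⟩ := hx'
    exact hker i x hx y hy hxy.symm
  · rw [← Submodule.map_iSup, hV.2, Submodule.map_top, LinearMap.range_eq_top.2 hf]

/-- Passing to the kernel of one `g i` costs at most one dimension, and the common kernel lies in
`N`. -/
theorem rank_le_card_add_rank {κ : Type*} (J : Finset κ) (g : κ → W →ₗ[F] W) (V N : Submodule F W)
    (hg : ∀ i ∈ J, ∃ u, ∀ x ∈ V, g i x ∈ Submodule.span F {u})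
    (hN : ∀ x ∈ V, (∀ i ∈ J, g i x = 0) → x ∈ N) :
    Module.rank F V ≤ J.card + Module.rank F N := by
  classical
  induction J using Finset.induction_on generalizing V with
  | empty =>
    rw [Finset.card_empty, Nat.cast_zero, zero_add]
    exact Submodule.rank_mono fun x hx => hN x hx (by simp)
  | insert a J ha ih =>
    have h1 := ih (V ⊓ LinearMap.ker (g a))
      (fun i hi => (hg i (Finset.mem_insert_of_mem hi)).imp fun u hu x hx => hu x hx.1)
      (fun x hx hJ => hN x hx.1 (Finset.forall_mem_insert _ _ _ |>.2 ⟨hx.2, hJ⟩))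
    obtain ⟨u, hu⟩ := hg a (Finset.mem_insert_self a J)
    have h2 := LinearMap.rank_range_add_rank_ker ((g a).domRestrict V)
    have h3 : Module.rank F (LinearMap.range ((g a).domRestrict V)) ≤ 1 := by
      refine (Submodule.rank_mono (t := Submodule.span F {u}) ?_).trans (by
        simpa using rank_span_le (R := F) ({u} : Set W))
      rintro _ ⟨x, rfl⟩
      exact hu x x.2
    have h4 : Module.rank F (LinearMap.ker ((g a).domRestrict V)) ≤
        Module.rank F ↥(V ⊓ LinearMap.ker (g a)) := by
      refine (Submodule.equivMapOfInjective V.subtype V.injective_subtype _).rank_eq.le.trans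
        (Submodule.rank_mono ?_)
      rintro _ ⟨x, hx, rfl⟩
      exact ⟨x.2, hx⟩
    rw [← h2, Finset.card_insert_of_notMem ha, Nat.cast_add, Nat.cast_one,
      add_comm (J.card : Cardinal), add_assoc]
    exact add_le_add h3 (h4.trans h1)

end LinearAlgebra

section

variable {F E : Type*} [Field F] [LieRing E] [LieAlgebra F E]
  {H : LieSubalgebra F E} {B : LinearMap.BilinForm F E}

theorem core_le_iSup_inf :
    (core H B).toSubmodule ≤ ⨆ α, rootSpace H α ⊓ (core H B).toSubmodule := by
  intro x hx
  induction hx using LieSubalgebra.lieSpan_induction with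
  | mem x hx =>
    obtain ⟨α, hα, hxα⟩ := Set.mem_iUnion₂.1 hx
    exact Submodule.mem_iSup_of_mem α ⟨hxα, LieSubalgebra.subset_lieSpan hx⟩
  | zero => exact zero_mem _
  | add x y _ _ hx hy => exact add_mem hx hy
  | smul c x _ hx => exact Submodule.smul_mem _ c hx
  | lie x y hx' hy' hx hy =>
    clear hx' hy'
    induction hx using Submodule.iSup_induction' with
    | mem α x hx =>
      induction hy using Submodule.iSup_induction' with
      | mem β y hy =>
        exact Submodule.mem_iSup_of_mem (α + β)
          ⟨lie_mem_rootSpace hx.1 hy.1, (core H B).lie_mem hx.2 hy.2⟩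
      | zero => simp
      | add a b _ _ ha hb => rw [lie_add]; exact add_mem ha hb
    | zero => simp
    | add a b _ _ ha hb => rw [add_lie]; exact add_mem ha hb

theorem IsToralPair.isGrading_coreRootSpace (hHB : IsToralPair H B) :
    IsGrading (coreRootSpace H B) :=
  hHB.toral.comap_subtype core_le_iSup_inf

/-- The centre is graded: if x - y is central, with x of degree α and y in the other degrees, then
for homogeneous w the equal brackets [w, x] and [w, y] have no degree in common and vanish. -/
theorem IsToralPair.isGrading_centrelessCoreRootSpace (hHB : IsToralPair H B) :
    IsGrading (centrelessCoreRootSpace H B) := by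
  have hgr := hHB.isGrading_coreRootSpace
  have hker : ∀ x : core H B,
      (LieSubmodule.Quotient.mk' (LieAlgebra.center F (core H B))).toLinearMap x = 0 ↔
        ∀ w : core H B, ⁅w, x⁆ = 0 := fun x => by
    rw [← LieModule.mem_maxTrivSubmodule F (core H B) (core H B)]
    exact LieSubmodule.Quotient.mk_eq_zero' (N := LieAlgebra.center F (core H B))
  refine hgr.map (LieSubmodule.Quotient.surjective_mk' _) fun α x hx y hy hxy => ?_
  rw [← sub_eq_zero, ← map_sub, hker] at hxy
  rw [hker]
  intro w
  have hw : w ∈ ⨆ β, coreRootSpace H B β := by rw [hgr.2]; trivial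
  induction hw using Submodule.iSup_induction' with
  | mem β w hw =>
    have hwx : ⁅w, x⁆ ∈ coreRootSpace H B (β + α) := lie_mem_rootSpace hw hx
    refine Submodule.disjoint_def.1 (hgr.1 (β + α)) _ hwx ?_
    rw [sub_eq_zero.1 ((lie_sub w x y).symm.trans (hxy w))]
    clear hxy
    rw [iSup_subtype'] at hy
    induction hy using Submodule.iSup_induction' with
    | mem γ y hy =>
      have hwy : ⁅w, y⁆ ∈ coreRootSpace H B (β + γ) := lie_mem_rootSpace hw hy
      refine Submodule.mem_iSup_of_mem (β + γ) (Submodule.mem_iSup_of_mem ?_ hwy)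
      simpa using γ.2
    | zero => simp
    | add a b _ _ ha hb => rw [lie_add]; exact add_mem ha hb
  | zero => simp
  | add a b _ _ ha hb => rw [add_lie, ha, hb, add_zero]

variable [CharZero F]

namespace IsExtendedAffine

variable (hE : IsExtendedAffine H B)

include hE

theorem rank_rootSpace_le_one {α : Module.Dual F H} (hα : dualForm H B α α ≠ 0) :
    Module.rank F (rootSpace H α) ≤ 1 := by
  obtain ⟨z, -, hz⟩ := hE.exists_rootSpace_eq_span α
  rw [hz hα]
  simpa using rank_span_le (R := F) ({z} : Set E)

theorem dualForm_add_self_of_nullRoot {α δ : Module.Dual F H} (hα : α ∈ anisotropicRoots H B)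
    (hδ : δ ∈ nullRoots H B) : dualForm H B (α + δ) (α + δ) = dualForm H B α α := by
  have h1 := hE.dualForm_eq_zero_of_nullRoot hδ hα
  simp only [hE.dualForm_add_left, hE.dualForm_add_right, hδ.2, h1, hE.dualForm_comm α δ]
  ring

/-- There is a bound for the homogeneous subspaces of the core, and modulo the core also for those
of the whole algebra. -/
theorem exists_bound : ∃ M : ℕ, ∀ δ : Module.Dual F H,
    Module.rank F (rootSpace H δ) ≤ M ∧
      Module.rank F ↥(rootSpace H δ ⊓ (core H B).toSubmodule) ≤ M := by
  classical
  obtain ⟨J, hJR, hJ⟩ := hE.exists_finite_core_eq_lieSpan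
  choose z hz hspan using hE.exists_rootSpace_eq_span
  -- A graded subspace with small components, built to contain the core: everything in nonisotropic
  -- degrees, and only brackets of chosen generators in isotropic ones.
  let C : Module.Dual F H → Submodule F E := fun δ =>
    if dualForm H B δ δ ≠ 0 then rootSpace H δ
    else Submodule.span F (J.image fun α => ⁅z α, z (δ - α)⁆ : Finset E)
  have hC : ∀ δ, C δ ≤ rootSpace H δ := by
    intro δ
    by_cases hδ : dualForm H B δ δ ≠ 0
    · simp [C, hδ]
    · simp only [C, if_neg hδ, Submodule.span_le]
      intro x hx
      obtain ⟨α, -, rfl⟩ := Finset.mem_image.1 hx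
      have := lie_mem_rootSpace (hz α) (hz (δ - α))
      rwa [add_sub_cancel] at this
  have hCrank : ∀ δ, Module.rank F (C δ) ≤ (J.card + 1 : ℕ) := by
    intro δ
    by_cases hδ : dualForm H B δ δ ≠ 0
    · have hCδ : C δ = _ := if_pos hδ
      rw [hCδ]
      refine (hE.rank_rootSpace_le_one hδ).trans ?_
      exact_mod_cast Nat.le_add_left 1 J.card
    · have hCδ : C δ = _ := if_neg hδ
      rw [hCδ]
      refine (rank_span_finset_le _).trans ?_
      exact_mod_cast Finset.card_image_le.trans (Nat.le_succ _)
  have hstable : ∀ α ∈ J, ∀ x ∈ rootSpace H α, ∀ w ∈ ⨆ β, C β, ⁅x, w⁆ ∈ ⨆ β, C β := by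
    intro α hα x hx w hw
    have hαR := hJR hα
    induction hw using Submodule.iSup_induction' with
    | mem β w hw =>
      have hwβ := hC β hw
      have hxw := lie_mem_rootSpace hx hwβ
      refine Submodule.mem_iSup_of_mem (α + β) ?_
      by_cases hn : dualForm H B (α + β) (α + β) ≠ 0
      · simpa only [C, if_pos hn] using hxw
      by_cases h0 : ⁅x, w⁆ = 0
      · rw [h0]; exact zero_mem _
      have hnull : α + β ∈ nullRoots H B := ⟨mem_roots_of_mem hxw h0, not_not.1 hn⟩
      -- β is the anisotropic root -α plus a null root, so its root space is spanned by `z β`.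
      have hβ : dualForm H B β β ≠ 0 := by
        have := hE.dualForm_add_self_of_nullRoot (hE.neg_mem_anisotropicRoots hαR) hnull
        rw [neg_add_cancel_left] at this
        rw [this]
        exact (hE.neg_mem_anisotropicRoots hαR).2
      rw [hspan α hαR.2, Submodule.mem_span_singleton] at hx
      rw [hspan β hβ, Submodule.mem_span_singleton] at hwβ
      obtain ⟨c, rfl⟩ := hx
      obtain ⟨d, rfl⟩ := hwβ
      simp only [C, if_neg hn, smul_lie, lie_smul]
      refine Submodule.smul_mem _ _ (Submodule.smul_mem _ _ (Submodule.subset_span ?_))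
      exact Finset.mem_coe.2 (Finset.mem_image.2 ⟨α, hα, by rw [add_sub_cancel_left]⟩)
    | zero => simp
    | add a b _ _ ha hb => rw [lie_add]; exact add_mem ha hb
  -- The sum of the `C β` is not known to be a subalgebra, so membership is proved together with
  -- stability under ad `x`.
  have hcore : ∀ x ∈ core H B, x ∈ (⨆ β, C β) ∧ ∀ w ∈ ⨆ β, C β, ⁅x, w⁆ ∈ ⨆ β, C β := by
    intro x hx
    rw [hJ] at hx
    induction hx using LieSubalgebra.lieSpan_induction with
    | mem x hx =>
      obtain ⟨α, hα, hxα⟩ := Set.mem_iUnion₂.1 hx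
      refine ⟨Submodule.mem_iSup_of_mem α ?_, hstable α hα x hxα⟩
      simpa only [C, if_pos (hJR hα).2, SetLike.mem_coe] using hxα
    | zero => simp
    | add x y _ _ hx hy =>
      exact ⟨add_mem hx.1 hy.1, fun w hw => by rw [add_lie]; exact add_mem (hx.2 w hw) (hy.2 w hw)⟩
    | smul c x _ hx =>
      exact ⟨Submodule.smul_mem _ c hx.1, fun w hw => by
        rw [smul_lie]; exact Submodule.smul_mem _ c (hx.2 w hw)⟩
    | lie x y _ _ hx hy =>
      exact ⟨hx.2 y hy.1, fun w hw => by
        rw [lie_lie]; exact sub_mem (hx.2 _ (hy.2 w hw)) (hy.2 _ (hx.2 w hw))⟩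
  have hinf : ∀ δ, rootSpace H δ ⊓ (core H B).toSubmodule ≤ C δ := fun δ x hx =>
    mem_of_mem_iSup_of_le hE.toral.1 hC (hcore x hx.2).1 hx.1
  refine ⟨J.card + (J.card + 1), fun δ => ⟨?_, ?_⟩⟩
  · by_cases hδ : dualForm H B δ δ = 0
    · rw [Nat.cast_add]
      refine (rank_le_card_add_rank J (fun α => (LieAlgebra.ad F E (z α) : E →ₗ[F] E))
        (rootSpace H δ) (C δ) (fun α hα => ⟨z (α + δ), fun x hx => ?_⟩) (fun x hx h0 => ?_)).trans
        (add_le_add le_rfl (hCrank δ))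
      · by_cases hx0 : x = 0
        · rw [hx0, map_zero]; exact zero_mem _
        rw [← hspan]
        · exact lie_mem_rootSpace (hz α) hx
        · rw [hE.dualForm_add_self_of_nullRoot (hJR hα) ⟨mem_roots_of_mem hx hx0, hδ⟩]
          exact (hJR hα).2
      -- An element commuting with the generators `z α`, α ∈ J, centralizes the core, so (EA5) puts
      -- it in the core.
      · refine hinf δ ⟨hx, hE.tame x fun y hy => ?_⟩
        rw [hJ] at hy
        induction hy using LieSubalgebra.lieSpan_induction with
        | mem y hy =>
          obtain ⟨α, hα, hyα⟩ := Set.mem_iUnion₂.1 hy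
          rw [SetLike.mem_coe, hspan α (hJR hα).2, Submodule.mem_span_singleton] at hyα
          obtain ⟨c, rfl⟩ := hyα
          have := h0 α hα
          rw [LieAlgebra.ad_apply] at this
          rw [lie_smul, ← lie_skew, this, neg_zero, smul_zero]
        | zero => simp
        | add a b _ _ ha hb => rw [lie_add, ha, hb, add_zero]
        | smul c a _ ha => rw [lie_smul, ha, smul_zero]
        | lie a b _ _ ha hb => rw [leibniz_lie, ha, hb, zero_lie, lie_zero, add_zero]
    · refine (hE.rank_rootSpace_le_one hδ).trans ?_
      exact_mod_cast (by omega : 1 ≤ J.card + (J.card + 1))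
  · refine (Submodule.rank_mono (hinf δ)).trans ((hCrank δ).trans ?_)
    exact_mod_cast Nat.le_add_left _ _

end IsExtendedAffine

end

end EALA

theorem propositionn {F E : Type*} [Field F] [CharZero F] [LieRing E] [LieAlgebra F E]
    (H : LieSubalgebra F E) (B : LinearMap.BilinForm F E)
    (hE : EALA.IsExtendedAffine H B) :
    EALA.HasFiniteBoundedDimension (EALA.rootSpace H) ∧
    EALA.HasFiniteBoundedDimension (EALA.coreRootSpace H B) ∧
    EALA.HasFiniteBoundedDimension (EALA.centrelessCoreRootSpace H B) := by
  obtain ⟨M, hM⟩ := hE.exists_bound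
  have hcore : ∀ α, Module.rank F (EALA.coreRootSpace H B α) ≤ M := fun α => by
    refine (Submodule.equivMapOfInjective (EALA.core H B).toSubmodule.subtype
      (Submodule.injective_subtype _) (EALA.coreRootSpace H B α)).rank_eq.le.trans
        ((Submodule.rank_mono ?_).trans (hM α).2)
    rintro _ ⟨x, hx, rfl⟩
    exact ⟨hx, x.2⟩
  exact ⟨⟨hE.toral, M, fun α => (hM α).1⟩, ⟨hE.isGrading_coreRootSpace, M, hcore⟩,
    ⟨hE.isGrading_centrelessCoreRootSpace, M, fun α => (rank_map_le _ _).trans (hcore α)⟩⟩
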